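/- Sequential probability assignment is the following game of $n$ rounds. In round $t$ Nature reveals side information $x_t\in\mathcal X$, the forecaster announces $\hat y_t\in[0,1]$, Nature chooses $p_t\in[0,1]$, and the outcome $y_t\in\{0,1\}$ is drawn from the Bernoulli distribution with mean $p_t$. The loss is $\ell(\hat y,1)=-\log\hat y$, $\ell(\hat y,0)=-\log(1-\hat y)$ (with $-\log 0=+\infty$). For a class $\mathcal F$ of functions $\mathcal X\to[0,1]$, the minimax regret is $$V_n(\mathcal F)=\sup_{x_1\in\mathcal X}\inf_{\hat y_1\in[0,1]}\sup_{p_1\in[0,1]}\mathbb E_{y_1\sim p_1}\cdots\sup_{x_n\in\mathcal X}\inf_{\hat y_n\in[0,1]}\sup_{p_n\in[0,1]}\mathbb E_{y_n\sim p_n}\Big\{\sum_{t=1}^n\ell(\hat y_t,y_t)-\inf_{f\in\mathcal F}\sum_{t=1}^n\ell(f(x_t),y_t)\Big\}.$$ Let $B$ be the closed unit ball of a real Hilbert space $E$ of finite or infinite dimension, let $\mathcal X=B$, and let $\mathcal F=\{x\mapsto(\langle w,x\rangle+1)/2 : w\in B\}$. **Lemma.** $V_n(\mathcal F)=\Theta^*(n^{1/2})$,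 where $\Theta^*$ ignores logarithmic factors and the constants do not depend on the dimension. Precisely: there are absolute constants $c,C>0$ and $k\in\mathbb N$ such that, for every real Hilbert space $E$ and every $n\ge 2$, $$V_n(\mathcal F)\le C\,\sqrt n\,(\log n)^k ,$$ and, whenever $\dim E\ge n$ (in particular for all $n\ge2$ if $E$ is infinite-dimensional), $$V_n(\mathcal F)\ge c\,\sqrt n\,(\log n)^{-k}.$$ -/

import Mathlib

open scoped InnerProductSpace

noncomputable section

/-- Logarithmic loss of predicting probability `a` for the event `y = 1` (`y = true`):
`-log a` if `y = 1` and `-log (1 - a)` if `y = 0`, with `-log 0 = +∞`. -/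
def logLoss (a : unitInterval) (y : Bool) : EReal :=
  if y then -ENNReal.log (ENNReal.ofReal (a : ℝ))
  else -ENNReal.log (ENNReal.ofReal (1 - (a : ℝ)))

/-- Regret against the class `F` after the rounds listed in `h`; an entry `(x, q, y)` records the
side information, the forecast and the outcome of one round. -/
def regret {𝒳 : Type*} (F : Set (𝒳 → unitInterval)) (h : List (𝒳 × unitInterval × Bool)) : EReal :=
  (h.map fun r => logLoss r.2.1 r.2.2).sum - ⨅ f ∈ F, (h.map fun r => logLoss (f r.1) r.2.2).sum

/-- Value of the game with `k` rounds to go after the rounds listed (chronologically) in `h`.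
`S` maps the past side information and outcomes to the set of side information allowed next.
In each round Nature picks `x`, the forecaster picks `q`, Nature picks the bias `p`, and the
outcome is drawn from Bernoulli `p`; in `EReal` one has `0 * ⊤ = 0`, so that outcomes of
probability zero do not contribute. -/
def gameValue {𝒳 : Type*} (S : List (𝒳 × Bool) → Set 𝒳) (F : Set (𝒳 → unitInterval)) :
    ℕ → List (𝒳 × unitInterval × Bool) → EReal
  | 0, h => regret F h
  | k + 1, h =>
      ⨆ x ∈ S (h.map fun r => (r.1, r.2.2)), ⨅ q : unitInterval, ⨆ p : unitInterval,
        (((p : ℝ) : EReal) * gameValue S F k (h ++ [(x, q, true)]) +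
          ((1 - (p : ℝ) : ℝ) : EReal) * gameValue S F k (h ++ [(x, q, false)]))

/-- Minimax regret `V_n(F)` under the side-information constraints `S`. -/
def minimaxRegret {𝒳 : Type*} (S : List (𝒳 × Bool) → Set 𝒳) (F : Set (𝒳 → unitInterval))
    (n : ℕ) : EReal :=
  gameValue S F n []

/-- Closed unit ball of `E`. -/
abbrev UnitBall (E : Type*) [NormedAddCommGroup E] : Type _ :=
  Metric.closedBall (0 : E) 1

theorem linear_mem_unitInterval {E : Type*} [NormedAddCommGroup E] [InnerProductSpace ℝ E]
    (w x : UnitBall E) : (⟪(w : E), (x : E)⟫_ℝ + 1) / 2 ∈ unitInterval := by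
  have hw : ‖(w : E)‖ ≤ 1 := mem_closedBall_zero_iff.mp w.2
  have hx : ‖(x : E)‖ ≤ 1 := mem_closedBall_zero_iff.mp x.2
  have h : |⟪(w : E), (x : E)⟫_ℝ| ≤ 1 :=
    (abs_real_inner_le_norm _ _).trans (mul_le_one₀ hw (norm_nonneg _) hx)
  obtain ⟨h1, h2⟩ := abs_le.mp h
  constructor <;> linarith

/-- The expert `x ↦ (⟨w, x⟩ + 1) / 2`. -/
def linearExpert {E : Type*} [NormedAddCommGroup E] [InnerProductSpace ℝ E]
    (w : UnitBall E) : UnitBall E → unitInterval :=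
  fun x => ⟨(⟪(w : E), (x : E)⟫_ℝ + 1) / 2, linear_mem_unitInterval w x⟩

/-- Linear experts indexed by the unit ball. -/
def linearClass (E : Type*) [NormedAddCommGroup E] [InnerProductSpace ℝ E] :
    Set (UnitBall E → unitInterval) :=
  Set.range linearExpert

/-- Minimax regret of the linear class when every point of the unit ball is allowed as side
information in every round. -/
def linearMinimaxRegret (E : Type*) [NormedAddCommGroup E] [InnerProductSpace ℝ E]
    (n : ℕ) : EReal :=
  minimaxRegret (fun _ => Set.univ) (linearClass E) n

end

open scoped InnerProductSpace

/-! ### The barrier of the ball and its mirror step. -/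

section Barrier

variable {E : Type*} [NormedAddCommGroup E] [InnerProductSpace ℝ E]

/-! With signed outcomes `z = ±x`, expert `u` loses `log 2 - log (1 + ⟨u, z⟩)`. For the upper bound
the forecaster runs mirror descent with the barrier `R w = -log (1 - ‖w‖²)` and step size `1 / l`.
One step costs `l` times a telescoping difference of divergences plus `1 / (l - 1)`
(`exists_mirror_step`). This holds although the gradients `z / (1 + ⟨w, z⟩)` are unbounded, because
the divergence controls the ratio `(1 + ⟨v, z⟩) / (1 + ⟨w, z⟩)` (`div_one_add_inner_le`). Experts
shrunk by `1 - 1/n` have divergence at most `log n` from `0`, and shrinking costs `O(1)` in total;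
`l = 1 + √n` balances the terms. No estimate involves the dimension.

For the lower bound Nature plays orthonormal vectors and fair coins. The forecaster loses at least
`log 2` per round on average, while the normalised signed sum of the vectors has margin `1/√n` in
every round and so gains about `n · (1/√n) = √n` (`le_gameValue_linearClass`). -/

theorem one_sub_norm_sq_pos {E : Type*} [NormedAddCommGroup E] {w : E} (hw : ‖w‖ < 1) : 0 < 1 - ‖w‖ ^ 2 := by
  nlinarith [norm_nonneg w]

theorem one_add_inner_pos {w z : E} (hw : ‖w‖ < 1) (hz : ‖z‖ ≤ 1) : 0 < 1 + ⟪w, z⟫_ℝ := by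
  have h1 := (abs_le.mp (abs_real_inner_le_norm w z)).1
  have h2 : ‖w‖ * ‖z‖ ≤ ‖w‖ * 1 := mul_le_mul_of_nonneg_left hz (norm_nonneg w)
  linarith

/-- Bregman divergence of the barrier `w ↦ -log (1 - ‖w‖²)` of the unit ball. -/
noncomputable def barrierDiv (u w : E) : ℝ :=
  Real.log (1 - ‖w‖ ^ 2) - Real.log (1 - ‖u‖ ^ 2) + 2 * (1 - ⟪u, w⟫_ℝ) / (1 - ‖w‖ ^ 2) - 2

theorem barrierDiv_zero_right (u : E) : barrierDiv u 0 = -Real.log (1 - ‖u‖ ^ 2) := by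
  simp [barrierDiv]

/-- The divergence splits over the two eigenvalues of `(1, v)` relative to `(1, w)` in the
Lorentz cone; the larger one bounds every ratio `(1 + ⟨v, z⟩) / (1 + ⟨w, z⟩)`. -/
theorem exists_barrierDiv_eq_add {v w : E} (hv : ‖v‖ < 1) (hw : ‖w‖ < 1) :
    ∃ a b : ℝ, 0 < a ∧ 0 < b ∧
      barrierDiv v w = (a - 1 - Real.log a) + (b - 1 - Real.log b) ∧
      ∀ z : E, ‖z‖ ≤ 1 → 1 + ⟪v, z⟫_ℝ ≤ a * (1 + ⟪w, z⟫_ℝ) := by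
  have hV := one_sub_norm_sq_pos hv
  have hW := one_sub_norm_sq_pos hw
  set V := 1 - ‖v‖ ^ 2 with hVd
  set W := 1 - ‖w‖ ^ 2 with hWd
  set p := ⟪v, w⟫_ℝ with hp
  have hp1 : p ≤ ‖v‖ * ‖w‖ := real_inner_le_norm v w
  have hvw : ‖v‖ * ‖w‖ < 1 := by nlinarith [norm_nonneg v, norm_nonneg w]
  -- Reversed Cauchy–Schwarz for the Lorentz form.
  have hdisc : V * W ≤ (1 - p) ^ 2 := by
    have h1 : (1 - ‖v‖ * ‖w‖) ^ 2 ≤ (1 - p) ^ 2 := pow_le_pow_left₀ (by linarith) (by linarith) 2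
    nlinarith [sq_nonneg (‖v‖ - ‖w‖)]
  set d := Real.sqrt ((1 - p) ^ 2 - V * W) with hd
  have hd2 : d ^ 2 = (1 - p) ^ 2 - V * W := Real.sq_sqrt (by linarith)
  have hd0 : 0 ≤ d := Real.sqrt_nonneg _
  have hdp : d < 1 - p := by
    have : 0 < V * W := mul_pos hV hW
    exact lt_of_pow_lt_pow_left₀ 2 (by linarith) (by linarith)
  have ha : 0 < (1 - p + d) / W := div_pos (by linarith) hW
  have hb : 0 < (1 - p - d) / W := div_pos (by linarith) hW
  -- The roots of `t² W - 2 t (1 - p) + V = (t - 1)² - ‖t w - v‖²`, the Lorentz form of `t (1, w) -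
  -- (1, v)`.
  refine ⟨(1 - p + d) / W, (1 - p - d) / W, ha, hb, ?_, ?_⟩
  · have hab : (1 - p + d) / W * ((1 - p - d) / W) = V / W := by
      field_simp
      linarith
    have hlog : Real.log ((1 - p + d) / W) + Real.log ((1 - p - d) / W)
        = Real.log V - Real.log W := by
      rw [← Real.log_mul ha.ne' hb.ne', hab, Real.log_div hV.ne' hW.ne']
    have hsum : (1 - p + d) / W + (1 - p - d) / W = 2 * (1 - p) / W := by
      field_simp
      ring
    unfold barrierDiv
    linarith
  · intro z hz
    set a := (1 - p + d) / W with had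
    have hroot : a ^ 2 * W - 2 * a * (1 - p) + V = 0 := by
      rw [had]
      field_simp
      linarith
    have hdist : ‖w - v‖ ^ 2 = ‖w‖ ^ 2 - 2 * p + ‖v‖ ^ 2 := by
      rw [norm_sub_sq_real, real_inner_comm]
    have ha1 : 1 ≤ a := by
      rw [had, le_div_iff₀ hW]
      have h1 : W - (1 - p) ≤ d := by
        refine (abs_le_of_sq_le_sq' ?_ hd0).2
        rw [hd2]
        nlinarith [mul_nonneg hW.le (sq_nonneg ‖w - v‖)]
      linarith
    -- So `a (1, w) - (1, v)` is on the boundary of the forward cone and pairs nonnegatively with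
    -- `(1, z)`.
    have hn : ‖a • w - v‖ = a - 1 := by
      rw [← sq_eq_sq₀ (norm_nonneg _) (by linarith), norm_sub_sq_real, norm_smul, inner_smul_left,
        real_inner_comm, Real.norm_of_nonneg ha.le, ← hp]
      simp only [conj_trivial]
      nlinarith
    have hi := (abs_le.mp (abs_real_inner_le_norm (a • w - v) z)).1
    rw [inner_sub_left, inner_smul_left, hn] at hi
    simp only [conj_trivial] at hi
    have : (a - 1) * ‖z‖ ≤ (a - 1) * 1 := mul_le_mul_of_nonneg_left hz (by linarith)
    linarith

theorem barrierDiv_nonneg {v w : E} (hv : ‖v‖ < 1) (hw : ‖w‖ < 1) : 0 ≤ barrierDiv v w := by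
  obtain ⟨a, b, ha, hb, h, -⟩ := exists_barrierDiv_eq_add hv hw
  linarith [Real.log_le_sub_one_of_pos ha, Real.log_le_sub_one_of_pos hb]

/-- The difference of the two sides is convex in `a` and smallest at `a = l / (l - 1)`; the proof
bounds `log a` by its tangent there and then uses `log x ≤ x - 1` once more. -/
theorem sub_one_le_mul_sub_log_add {l a : ℝ} (hl : 1 < l) (ha : 0 < a) :
    a - 1 ≤ l * (a - 1 - Real.log a) + 1 / (l - 1) := by
  have hl1 : 0 < l - 1 := by linarith
  have hk : 0 < l / (l - 1) := by positivity
  have h1 := Real.log_le_sub_one_of_pos (div_pos ha hk)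
  rw [Real.log_div ha.ne' hk.ne'] at h1
  have h2 := Real.log_le_sub_one_of_pos hk
  have h3 : l * Real.log a ≤ l * (a / (l / (l - 1)) - 1 + (l / (l - 1) - 1)) :=
    mul_le_mul_of_nonneg_left (by linarith) (by linarith)
  have h4 : l * (a / (l / (l - 1)) - 1 + (l / (l - 1) - 1))
      = a * (l - 1) - l + 1 + 1 / (l - 1) := by
    field_simp
    ring
  linarith

/-- Stability of the mirror step: moving from `w` to `v` raises the linearised gain by little beyond
what the divergence pays for, however close `1 + ⟨w, z⟩` is to `0`. -/
theorem div_one_add_inner_le {l : ℝ} (hl : 1 < l) {v w z : E} (hv : ‖v‖ < 1) (hw : ‖w‖ < 1)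
    (hz : ‖z‖ ≤ 1) :
    (1 + ⟪v, z⟫_ℝ) / (1 + ⟪w, z⟫_ℝ) - 1 ≤ l * barrierDiv v w + 1 / (l - 1) := by
  obtain ⟨a, b, ha, hb, h, h'⟩ := exists_barrierDiv_eq_add hv hw
  have h1 : (1 + ⟪v, z⟫_ℝ) / (1 + ⟪w, z⟫_ℝ) ≤ a :=
    (div_le_iff₀ (one_add_inner_pos hw hz)).mpr (h' z hz)
  have h2 := sub_one_le_mul_sub_log_add hl ha
  have h3 : 0 ≤ l * (b - 1 - Real.log b) :=
    mul_nonneg (by linarith) (by linarith [Real.log_le_sub_one_of_pos hb])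
  rw [h]
  linarith

/-- The gradient of the barrier maps the open unit ball onto the whole space. -/
theorem exists_barrier_gradient_eq (G : E) :
    ∃ w : E, ‖w‖ < 1 ∧ (2 / (1 - ‖w‖ ^ 2)) • w = G := by
  set s := Real.sqrt (1 + ‖G‖ ^ 2) with hs
  have hs2 : s ^ 2 = 1 + ‖G‖ ^ 2 := Real.sq_sqrt (by positivity)
  have hs0 : 0 ≤ s := Real.sqrt_nonneg _
  have h1 : 0 < 1 + s := by linarith
  have hG : ‖G‖ ^ 2 = (s - 1) * (s + 1) := by linarith
  have hn : ‖(1 / (1 + s)) • G‖ ^ 2 = 1 - 2 * (1 / (1 + s)) := by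
    rw [norm_smul, Real.norm_of_nonneg (by positivity), mul_pow, hG]
    field_simp
    ring
  -- Solves the radial equation `2 r / (1 - r²) = ‖G‖`.
  refine ⟨(1 / (1 + s)) • G, ?_, ?_⟩
  · have : 0 < 1 / (1 + s) := by positivity
    exact lt_of_pow_lt_pow_left₀ 2 zero_le_one (by linarith)
  · rw [hn, smul_smul]
    have : 2 / (1 - (1 - 2 * (1 / (1 + s)))) * (1 / (1 + s)) = 1 := by
      field_simp
      ring
    rw [this, one_smul]

theorem barrierDiv_three_point {u v w : E} (hv : ‖v‖ < 1) :
    barrierDiv u w - barrierDiv u v - barrierDiv v w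
      = ⟪(2 / (1 - ‖v‖ ^ 2)) • v - (2 / (1 - ‖w‖ ^ 2)) • w, u - v⟫_ℝ := by
  have hV := one_sub_norm_sq_pos hv
  unfold barrierDiv
  simp only [inner_sub_left, inner_sub_right, real_inner_smul_left,
    real_inner_self_eq_norm_sq]
  rw [real_inner_comm u v, real_inner_comm u w, real_inner_comm v w]
  have : 2 * (1 - ⟪u, v⟫_ℝ) / (1 - ‖v‖ ^ 2) - 2
      = 2 / (1 - ‖v‖ ^ 2) * ‖v‖ ^ 2 - 2 / (1 - ‖v‖ ^ 2) * ⟪u, v⟫_ℝ := by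
    field_simp
    ring
  linear_combination -this

/-- One step of mirror descent with the barrier for the losses `u ↦ -log (1 + ⟨u, z⟩)`. -/
theorem exists_mirror_step {l : ℝ} (hl : 1 < l) {w z : E} (hw : ‖w‖ < 1) (hz : ‖z‖ ≤ 1) :
    ∃ w' : E, ‖w'‖ < 1 ∧ ∀ u : E, ‖u‖ < 1 →
      Real.log (1 + ⟪u, z⟫_ℝ) - Real.log (1 + ⟪w, z⟫_ℝ)
        ≤ l * (barrierDiv u w - barrierDiv u w') + 1 / (l - 1) := by
  have hl0 : 0 < l := by linarith
  have hwz := one_add_inner_pos hw hz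
  -- A dual step of size `1 / l` along the gradient `z / (1 + ⟨w, z⟩)` of the gain at `w`; no
  -- projection is needed.
  obtain ⟨v, hv, hvG⟩ := exists_barrier_gradient_eq
    ((2 / (1 - ‖w‖ ^ 2)) • w + (1 / (l * (1 + ⟪w, z⟫_ℝ))) • z)
  refine ⟨v, hv, fun u hu => ?_⟩
  have huz := one_add_inner_pos hu hz
  have h3 := barrierDiv_three_point (u := u) (w := w) hv
  rw [hvG, add_sub_cancel_left, inner_smul_left, conj_trivial, inner_sub_right,
    real_inner_comm u, real_inner_comm v] at h3
  have h4 : l * (1 / (l * (1 + ⟪w, z⟫_ℝ)) * (⟪u, z⟫_ℝ - ⟪v, z⟫_ℝ))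
      = (1 + ⟪u, z⟫_ℝ) / (1 + ⟪w, z⟫_ℝ) - (1 + ⟪v, z⟫_ℝ) / (1 + ⟪w, z⟫_ℝ) := by
    field_simp
    ring
  have h5 := div_one_add_inner_le hl hv hw hz
  -- Concavity of the gain: its increase from `w` to `u` is at most the linearised one.
  have h6 := Real.log_le_sub_one_of_pos (div_pos huz hwz)
  rw [Real.log_div huz.ne' hwz.ne'] at h6
  rw [← h3] at h4
  linarith

end Barrier

/-! ### Logarithmic loss and extended-real sums. -/

section Loss

/-- The outcome as a sign. -/
def outcomeSign (y : Bool) : ℝ := if y then 1 else -1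

theorem abs_outcomeSign (y : Bool) : |outcomeSign y| = 1 := by
  cases y <;> simp [outcomeSign]

theorem outcomeSign_mul_self (y : Bool) : outcomeSign y * outcomeSign y = 1 := by
  cases y <;> simp [outcomeSign]

theorem neg_log_ofReal_eq {r : ℝ} (hr : 0 < r) :
    -ENNReal.log (ENNReal.ofReal r) = ((-Real.log r : ℝ) : EReal) := by
  rw [ENNReal.log_ofReal_of_pos hr, EReal.coe_neg]

/-- In terms of `b = 2 a - 1` the loss is `log 2 - log (1 ± b)`. -/
theorem logLoss_eq (a : unitInterval) (y : Bool) (b : ℝ) (hab : (a : ℝ) = (b + 1) / 2)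
    (h : 0 < 1 + outcomeSign y * b) :
    logLoss a y = ((Real.log 2 - Real.log (1 + outcomeSign y * b) : ℝ) : EReal) := by
  rw [← neg_sub (Real.log _), ← Real.log_div h.ne' two_ne_zero,
    ← neg_log_ofReal_eq (div_pos h two_pos)]
  cases y
  · simp only [logLoss, outcomeSign, hab, Bool.false_eq_true, if_false]
    congr 3
    ring
  · simp only [logLoss, outcomeSign, hab, if_true]
    congr 3
    ring

theorem logLoss_eq_top (a : unitInterval) (y : Bool) (b : ℝ) (hab : (a : ℝ) = (b + 1) / 2)
    (h : 1 + outcomeSign y * b ≤ 0) : logLoss a y = ⊤ := by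
  cases y
  · simp only [outcomeSign, Bool.false_eq_true, if_false] at h
    have : ENNReal.ofReal (1 - (a : ℝ)) = 0 := ENNReal.ofReal_eq_zero.mpr (by linarith)
    simp [logLoss, this]
  · simp only [outcomeSign, if_true] at h
    have : ENNReal.ofReal (a : ℝ) = 0 := ENNReal.ofReal_eq_zero.mpr (by linarith)
    simp [logLoss, this]

/-- Under a fair coin every forecast loses at least `log 2` in expectation. -/
theorem exists_le_logLoss_fair (q : unitInterval) :
    ∃ a b : ℝ, (a : EReal) ≤ logLoss q true ∧ (b : EReal) ≤ logLoss q false ∧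
      2 * Real.log 2 ≤ a + b := by
  have hq : (q : ℝ) = ((2 * (q : ℝ) - 1) + 1) / 2 := by ring
  have h0 := q.2.1
  have h1 := q.2.2
  rcases h0.eq_or_lt with h | h
  -- At an extreme forecast one loss is `⊤` and the other is `0`, so the infinite one admits any
  -- real lower bound.
  · refine ⟨2 * Real.log 2, 0, ?_, ?_, by simp⟩
    · rw [logLoss_eq_top q true _ hq (by simp [outcomeSign, ← h])]
      exact le_top
    · simp [logLoss, ← h]
  rcases h1.eq_or_lt with h' | h'
  · refine ⟨0, 2 * Real.log 2, ?_, ?_, by simp⟩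
    · simp [logLoss, h']
    · rw [logLoss_eq_top q false _ hq (by simp only [outcomeSign, h']; norm_num)]
      exact le_top
  refine ⟨_, _, (logLoss_eq q true _ hq ?_).ge, (logLoss_eq q false _ hq ?_).ge, ?_⟩
  · simp only [outcomeSign, if_true]
    linarith
  · simp only [outcomeSign, Bool.false_eq_true, if_false]
    linarith
  · simp only [outcomeSign, Bool.false_eq_true, if_false, if_true]
    have hp : 0 < (1 + 1 * (2 * (q : ℝ) - 1)) * (1 + -1 * (2 * (q : ℝ) - 1)) :=
      mul_pos (by linarith) (by linarith)
    have h3 : Real.log ((1 + 1 * (2 * (q : ℝ) - 1)) * (1 + -1 * (2 * (q : ℝ) - 1))) ≤ 0 :=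
      Real.log_nonpos hp.le (by nlinarith [sq_nonneg (2 * (q : ℝ) - 1)])
    rw [Real.log_mul (by linarith) (by linarith)] at h3
    linarith

theorem coe_list_sum_map_le {α : Type*} (φ : α → ℝ) (ψ : α → EReal) (h : List α)
    (H : ∀ r ∈ h, (φ r : EReal) ≤ ψ r) : ((h.map φ).sum : EReal) ≤ (h.map ψ).sum := by
  induction h with
  | nil => simp
  | cons a t ih =>
    simp only [List.map_cons, List.sum_cons, EReal.coe_add]
    exact add_le_add (H a (by simp)) (ih fun r hr => H r (by simp [hr]))

theorem list_sum_map_sub_const {α : Type*} (φ : α → ℝ) (c : ℝ) (h : List α) :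
    (h.map fun r => φ r - c).sum = (h.map φ).sum - h.length * c := by
  induction h with
  | nil => simp
  | cons a t ih =>
    simp only [List.map_cons, List.sum_cons, ih, List.length_cons]
    push_cast
    ring

/-- Makes Nature's bias irrelevant to the upper bound, which holds for each outcome separately. -/
theorem bernoulli_average_le {V₁ V₂ C : EReal} (p : unitInterval) (h₁ : V₁ ≤ C) (h₂ : V₂ ≤ C) :
    ((p : ℝ) : EReal) * V₁ + ((1 - (p : ℝ) : ℝ) : EReal) * V₂ ≤ C := by
  have hp : (0 : EReal) ≤ ((p : ℝ) : EReal) := EReal.coe_nonneg.mpr p.2.1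
  have hp' : (0 : EReal) ≤ ((1 - (p : ℝ) : ℝ) : EReal) :=
    EReal.coe_nonneg.mpr (sub_nonneg.mpr p.2.2)
  calc _ ≤ ((p : ℝ) : EReal) * C + ((1 - (p : ℝ) : ℝ) : EReal) * C :=
        add_le_add (mul_le_mul_of_nonneg_left h₁ hp) (mul_le_mul_of_nonneg_left h₂ hp')
    _ = C := by
        rw [← EReal.right_distrib_of_nonneg hp hp', ← EReal.coe_add]
        simp

end Loss

/-! ### Upper bound by mirror descent. -/

section Upper

variable {E : Type*} [NormedAddCommGroup E] [InnerProductSpace ℝ E]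

theorem norm_smul_outcomeSign_le (y : Bool) (x : UnitBall E) :
    ‖outcomeSign y • (x : E)‖ ≤ 1 := by
  rw [norm_smul, Real.norm_eq_abs, abs_outcomeSign, one_mul]
  exact mem_closedBall_zero_iff.mp x.2

/-- Loss of the linear expert `u` in one round, for `u` in the open ball. -/
noncomputable def innerLoss (u : E) (r : UnitBall E × unitInterval × Bool) : ℝ :=
  Real.log 2 - Real.log (1 + outcomeSign r.2.2 * ⟪u, (r.1 : E)⟫_ℝ)

/-- Shrinking an expert by a factor `c` costs at most `-log c` per round. -/
theorem innerLoss_smul_le {c : ℝ} (hc0 : 0 < c) (hc1 : c < 1) (w : UnitBall E)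
    (r : UnitBall E × unitInterval × Bool) :
    ((innerLoss (c • (w : E)) r - -Real.log c : ℝ) : EReal)
      ≤ logLoss (linearExpert w r.1) r.2.2 := by
  rcases le_or_gt (1 + outcomeSign r.2.2 * ⟪(w : E), (r.1 : E)⟫_ℝ) 0 with h | h
  · rw [logLoss_eq_top _ _ _ rfl h]
    exact le_top
  · rw [logLoss_eq _ _ _ rfl h, EReal.coe_le_coe_iff, innerLoss, inner_smul_left, conj_trivial]
    have h1 : Real.log (c * (1 + outcomeSign r.2.2 * ⟪(w : E), (r.1 : E)⟫_ℝ))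
        ≤ Real.log (1 + outcomeSign r.2.2 * (c * ⟪(w : E), (r.1 : E)⟫_ℝ)) :=
      Real.log_le_log (mul_pos hc0 h) (by linarith)
    rw [Real.log_mul hc0.ne' h.ne'] at h1
    linarith

/-- Experts on the unit sphere may have infinite loss or divergence, so the comparison is made with
their shrunk copies in the ball of radius `c`. -/
theorem regret_linearClass_le {c L K : ℝ} (hc0 : 0 < c) (hc1 : c < 1)
    (h : List (UnitBall E × unitInterval × Bool))
    (hL : (h.map fun r => logLoss r.2.1 r.2.2).sum ≤ (L : EReal))
    (hK : ∀ u : E, ‖u‖ ≤ c → L ≤ (h.map (innerLoss u)).sum + K) :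
    regret (linearClass E) h ≤ ((K + h.length * -Real.log c : ℝ) : EReal) := by
  unfold regret
  have key : ((L - (K + h.length * -Real.log c) : ℝ) : EReal)
      ≤ ⨅ f ∈ linearClass E, (h.map fun r => logLoss (f r.1) r.2.2).sum := by
    refine le_iInf₂ ?_
    rintro _ ⟨w, rfl⟩
    refine le_trans ?_ (coe_list_sum_map_le (fun r => innerLoss (c • (w : E)) r - -Real.log c) _ h
      fun r _ => innerLoss_smul_le hc0 hc1 w r)
    rw [EReal.coe_le_coe_iff, list_sum_map_sub_const]
    have hw : ‖(w : E)‖ ≤ 1 := mem_closedBall_zero_iff.mp w.2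
    have := hK (c • (w : E)) (by
      rw [norm_smul, Real.norm_of_nonneg hc0.le]
      nlinarith)
    linarith
  refine (EReal.sub_le_sub hL key).trans ?_
  rw [← EReal.coe_sub, EReal.coe_le_coe_iff]
  linarith

/-- Here `w` is the current iterate and `L` bounds the forecaster's loss so far. The last hypothesis
is the telescoped mirror descent inequality, the invariant kept from round to round. -/
theorem gameValue_linearClass_le {c l : ℝ} (hc0 : 0 < c) (hc1 : c < 1) (hl : 1 < l) (k : ℕ) :
    ∀ (h : List (UnitBall E × unitInterval × Bool)) (w : E) (L : ℝ), ‖w‖ < 1 →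
      (h.map fun r => logLoss r.2.1 r.2.2).sum ≤ (L : EReal) →
      (∀ u : E, ‖u‖ < 1 → L ≤ (h.map (innerLoss u)).sum
        + (l * (barrierDiv u 0 - barrierDiv u w) + h.length * (1 / (l - 1)))) →
      gameValue (fun _ => Set.univ) (linearClass E) k h
        ≤ ((l * -Real.log (1 - c ^ 2) + (h.length + k : ℕ) * (1 / (l - 1) + -Real.log c) : ℝ)
          : EReal) := by
  induction k with
  | zero =>
    intro h w L hw hL hu
    refine (regret_linearClass_le (K := l * -Real.log (1 - c ^ 2) + h.length * (1 / (l - 1)))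
      hc0 hc1 h hL fun u huc => ?_).trans ?_
    · have hu1 : ‖u‖ < 1 := by linarith
      have h1 := hu u hu1
      have h2 := barrierDiv_nonneg hu1 hw
      have h3 : barrierDiv u 0 ≤ -Real.log (1 - c ^ 2) := by
        rw [barrierDiv_zero_right, neg_le_neg_iff]
        refine Real.log_le_log (by nlinarith) ?_
        have := pow_le_pow_left₀ (norm_nonneg u) huc 2
        linarith
      have h4 : l * (barrierDiv u 0 - barrierDiv u w) ≤ l * -Real.log (1 - c ^ 2) :=
        mul_le_mul_of_nonneg_left (by linarith) (by linarith)
      linarith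
    · rw [EReal.coe_le_coe_iff, add_zero]
      linarith
  | succ k ih =>
    intro h w L hw hL hu
    rw [gameValue]
    refine iSup₂_le fun x _ => ?_
    have hw' : w ∈ Metric.closedBall (0 : E) 1 := mem_closedBall_zero_iff.mpr hw.le
    refine (iInf_le _ (linearExpert ⟨w, hw'⟩ x)).trans (iSup_le fun p => ?_)
    have step : ∀ y : Bool, gameValue (fun _ => Set.univ) (linearClass E) k
        (h ++ [(x, linearExpert ⟨w, hw'⟩ x, y)])
        ≤ ((l * -Real.log (1 - c ^ 2) + (h.length + (k + 1) : ℕ) * (1 / (l - 1) + -Real.log c) : ℝ)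
          : EReal) := by
      intro y
      have hz := norm_smul_outcomeSign_le y x
      obtain ⟨v, hv, hstep⟩ := exists_mirror_step hl hw hz
      have hpos := one_add_inner_pos hw hz
      rw [inner_smul_right] at hpos
      have := ih (h ++ [(x, linearExpert ⟨w, hw'⟩ x, y)]) v
        (L + (Real.log 2 - Real.log (1 + outcomeSign y * ⟪w, (x : E)⟫_ℝ))) hv ?_ ?_
      · rw [List.length_append, List.length_singleton, Nat.add_assoc, Nat.add_comm 1 k] at this
        exact this
      · rw [List.map_append, List.sum_append, EReal.coe_add]
        refine add_le_add hL ?_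
        simp only [List.map_cons, List.map_nil, List.sum_cons, List.sum_nil, add_zero]
        exact (logLoss_eq _ _ _ rfl hpos).le
      · intro u hu1
        have h1 := hu u hu1
        have h2 := hstep u hu1
        rw [inner_smul_right, inner_smul_right] at h2
        rw [List.map_append, List.sum_append, List.length_append]
        simp only [List.map_cons, List.map_nil, List.sum_cons, List.sum_nil, add_zero,
          List.length_singleton, innerLoss]
        push_cast
        linarith
    exact bernoulli_average_le p (step true) (step false)

theorem linearMinimaxRegret_le {n : ℕ} (hn : 2 ≤ n) :
    linearMinimaxRegret E n ≤ ((8 * Real.sqrt n * Real.log n : ℝ) : EReal) := by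
  have hn' : (2 : ℝ) ≤ n := by exact_mod_cast hn
  have hn0 : (0 : ℝ) < n := by linarith
  have hs1 : 1 ≤ Real.sqrt n := Real.one_le_sqrt.mpr (by linarith)
  have hss : Real.sqrt n * Real.sqrt n = n := Real.mul_self_sqrt hn0.le
  have hinv : 0 < 1 / (n : ℝ) := by positivity
  have hinv' : 1 / (n : ℝ) ≤ 1 / 2 := one_div_le_one_div_of_le two_pos hn'
  have hc0 : 0 < 1 - 1 / (n : ℝ) := by linarith
  have hl : 1 < 1 + Real.sqrt n := by linarith
  -- The total is at most `(1 + √n) log n + √n + 2`; since `√n ≥ 1` and `log n ≥ 1/2`, this is at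
  -- most `(2 + 2 + 4) √n log n`.
  refine (gameValue_linearClass_le (c := 1 - 1 / (n : ℝ)) (l := 1 + Real.sqrt n) hc0
    (by linarith) hl n [] 0 0 (by simp) (by simp) (by simp)).trans ?_
  rw [EReal.coe_le_coe_iff]
  simp only [List.length_nil, zero_add, add_sub_cancel_left]
  have h1 : -Real.log (1 - (1 - 1 / (n : ℝ)) ^ 2) ≤ Real.log n := by
    have : Real.log (1 / (n : ℝ)) ≤ Real.log (1 - (1 - 1 / (n : ℝ)) ^ 2) :=
      Real.log_le_log hinv (by nlinarith)
    rw [one_div, Real.log_inv, ← one_div] at this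
    linarith
  have h2 : n * -Real.log (1 - 1 / (n : ℝ)) ≤ 2 := by
    have h := Real.one_sub_inv_le_log_of_pos hc0
    have h3 : n * ((1 - 1 / (n : ℝ))⁻¹ - 1) ≤ 2 := by
      have e : 1 - 1 / (n : ℝ) = (n - 1) / n := by field_simp
      have hn1 : (0 : ℝ) < n - 1 := by linarith
      have : n * ((1 - 1 / (n : ℝ))⁻¹ - 1) = n / (n - 1) := by
        rw [e]
        field_simp
        ring
      rw [this, div_le_iff₀ hn1]
      linarith
    have h4 : n * -Real.log (1 - 1 / (n : ℝ)) ≤ n * ((1 - 1 / (n : ℝ))⁻¹ - 1) :=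
      mul_le_mul_of_nonneg_left (by linarith) hn0.le
    linarith
  have h3 : n * (1 / Real.sqrt n) = Real.sqrt n := by
    field_simp
    linarith
  have hlog : 1 / 2 ≤ Real.log n := by
    have := Real.log_le_log two_pos hn'
    linarith [Real.log_two_gt_d9]
  have h4 : (1 + Real.sqrt n) * -Real.log (1 - (1 - 1 / (n : ℝ)) ^ 2)
      ≤ (1 + Real.sqrt n) * Real.log n := mul_le_mul_of_nonneg_left h1 (by linarith)
  rw [mul_add, h3]
  nlinarith [mul_nonneg (sub_nonneg.mpr hs1) (sub_nonneg.mpr hlog)]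

end Upper

/-! ### Lower bound by orthonormal vectors and fair coins. -/

section Lower

variable {E : Type*} [NormedAddCommGroup E] [InnerProductSpace ℝ E]

/-- Nature reveals orthonormal vectors and tosses fair coins; `v` collects the expert with
margin `a` on all past rounds. -/
theorem le_gameValue_linearClass {n : ℕ} {e : Fin n → E} (he : Orthonormal ℝ e) {a : ℝ}
    (ha0 : 0 ≤ a) (ha : n * a ^ 2 ≤ 1) (k : ℕ) :
    ∀ (h : List (UnitBall E × unitInterval × Bool)) (v : E) (L : ℝ), h.length + k = n →
      (L : EReal) ≤ (h.map fun r => logLoss r.2.1 r.2.2).sum →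
      ‖v‖ ^ 2 = h.length * a ^ 2 →
      (∀ j : Fin n, h.length ≤ j → ⟪v, e j⟫_ℝ = 0) →
      (∀ r ∈ h, ⟪v, (r.1 : E)⟫_ℝ = outcomeSign r.2.2 * a) →
      (∀ r ∈ h, ∀ j : Fin n, h.length ≤ j → ⟪e j, (r.1 : E)⟫_ℝ = 0) →
      ((L + k * Real.log 2 - n * (Real.log 2 - Real.log (1 + a)) : ℝ) : EReal)
        ≤ gameValue (fun _ => Set.univ) (linearClass E) k h := by
  induction k with
  | zero =>
    intro h v L hlen hL hv _ hr _
    rw [add_zero] at hlen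
    rw [gameValue, regret]
    have hv1 : v ∈ Metric.closedBall (0 : E) 1 := by
      rw [mem_closedBall_zero_iff]
      rw [hlen] at hv
      exact (abs_le_of_sq_le_sq' (by linarith) zero_le_one).2
    have hinf : (⨅ f ∈ linearClass E, (h.map fun r => logLoss (f r.1) r.2.2).sum)
        ≤ ((n * (Real.log 2 - Real.log (1 + a)) : ℝ) : EReal) := by
      refine (iInf₂_le _ ⟨⟨v, hv1⟩, rfl⟩).trans ?_
      have hmap : (h.map fun r => logLoss (linearExpert ⟨v, hv1⟩ r.1) r.2.2)
          = h.map fun _ => ((Real.log 2 - Real.log (1 + a) : ℝ) : EReal) := by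
        refine List.map_congr_left fun r hrh => ?_
        have hb : outcomeSign r.2.2 * ⟪v, (r.1 : E)⟫_ℝ = a := by
          rw [hr r hrh, ← mul_assoc, outcomeSign_mul_self, one_mul]
        rw [logLoss_eq _ _ ⟪v, (r.1 : E)⟫_ℝ rfl (by rw [hb]; linarith), hb]
      rw [hmap, List.map_const', List.sum_replicate, hlen, ← EReal.coe_nsmul, nsmul_eq_mul]
    rw [EReal.coe_sub]
    refine EReal.sub_le_sub ?_ hinf
    simpa using hL
  | succ k ih =>
    intro h v L hlen hL hv hve hr hre
    have hlt : h.length < n := by omega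
    set i : Fin n := ⟨h.length, hlt⟩ with hi
    -- The first unused vector; indices start at `0`, so those `≥ h.length` are still unused.
    have hx : e i ∈ Metric.closedBall (0 : E) 1 :=
      mem_closedBall_zero_iff.mpr (he.1 i).le
    have hii : ⟪e i, e i⟫_ℝ = 1 := by rw [real_inner_self_eq_norm_sq, he.1 i, one_pow]
    have hvi : ⟪v, e i⟫_ℝ = 0 := hve i le_rfl
    have hij : ∀ j : Fin n, h.length + 1 ≤ j → ⟪e i, e j⟫_ℝ = 0 := by
      intro j hj
      refine he.2 fun hc => ?_
      have : (i : ℕ) = j := congrArg Fin.val hc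
      simp only [hi] at this
      omega
    rw [gameValue]
    refine le_iSup₂_of_le (⟨e i, hx⟩ : UnitBall E) (Set.mem_univ _) (le_iInf fun q => ?_)
    refine le_iSup_of_le (⟨1 / 2, by norm_num, by norm_num⟩ : unitInterval) ?_
    obtain ⟨b₁, b₂, hb₁, hb₂, hb⟩ := exists_le_logLoss_fair q
    have step : ∀ (y : Bool) (b : ℝ), (b : EReal) ≤ logLoss q y →
        ((L + b + k * Real.log 2 - n * (Real.log 2 - Real.log (1 + a)) : ℝ) : EReal)
          ≤ gameValue (fun _ => Set.univ) (linearClass E) k (h ++ [(⟨e i, hx⟩, q, y)]) := by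
      intro y b hby
      -- By orthogonality the added term leaves past margins unchanged, gives margin `a` in the new
      -- round, and adds `a²` to `‖v‖²`.
      refine ih _ (v + (outcomeSign y * a) • e i) _ ?_ ?_ ?_ ?_ ?_ ?_
      · simp only [List.length_append, List.length_singleton]
        omega
      · rw [List.map_append, List.sum_append, EReal.coe_add]
        refine add_le_add hL ?_
        simpa using hby
      · rw [norm_add_sq_real, inner_smul_right, hvi, hv, norm_smul, he.1 i, Real.norm_eq_abs,
          abs_mul, abs_outcomeSign, abs_of_nonneg ha0, List.length_append, List.length_singleton]
        push_cast
        ring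
      · intro j hj
        simp only [List.length_append, List.length_singleton] at hj
        rw [inner_add_left, inner_smul_left, hij j hj, hve j (by omega)]
        simp
      · intro r hrm
        rw [List.mem_append, List.mem_singleton] at hrm
        rcases hrm with hrm | rfl
        · rw [inner_add_left, inner_smul_left, hre r hrm i le_rfl, hr r hrm]
          simp
        · rw [inner_add_left, inner_smul_left, hvi, hii]
          simp
      · intro r hrm j hj
        simp only [List.length_append, List.length_singleton] at hj
        rw [List.mem_append, List.mem_singleton] at hrm
        rcases hrm with hrm | rfl
        · exact hre r hrm j (by omega)
        · rw [real_inner_comm]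
          exact hij j hj
    have hhalf : (0 : EReal) ≤ ((1 / 2 : ℝ) : EReal) := EReal.coe_nonneg.mpr (by norm_num)
    have hhalf' : (0 : EReal) ≤ ((1 - 1 / 2 : ℝ) : EReal) := EReal.coe_nonneg.mpr (by norm_num)
    refine le_trans ?_ (add_le_add (mul_le_mul_of_nonneg_left (step true b₁ hb₁) hhalf)
      (mul_le_mul_of_nonneg_left (step false b₂ hb₂) hhalf'))
    rw [← EReal.coe_mul, ← EReal.coe_mul, ← EReal.coe_add, EReal.coe_le_coe_iff]
    push_cast
    linarith

theorem exists_orthonormal_of_le_rank {n : ℕ} (h : (n : Cardinal) ≤ Module.rank ℝ E) :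
    ∃ e : Fin n → E, Orthonormal ℝ e := by
  obtain ⟨v, hv⟩ := Module.le_rank_iff.mp h
  exact ⟨_, InnerProductSpace.gramSchmidtNormed_orthonormal hv⟩

theorem le_linearMinimaxRegret {n : ℕ} (hn : 2 ≤ n) (h : (n : Cardinal) ≤ Module.rank ℝ E) :
    ((1 / 4 * Real.sqrt n / Real.log n : ℝ) : EReal) ≤ linearMinimaxRegret E n := by
  obtain ⟨e, he⟩ := exists_orthonormal_of_le_rank h
  have hn' : (2 : ℝ) ≤ n := by exact_mod_cast hn
  have hn0 : (0 : ℝ) < n := by linarith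
  have hs1 : 1 ≤ Real.sqrt n := Real.one_le_sqrt.mpr (by linarith)
  have hss : Real.sqrt n ^ 2 = n := Real.sq_sqrt hn0.le
  have ha : n * (1 / Real.sqrt n) ^ 2 ≤ 1 := by
    rw [div_pow, hss]
    field_simp
    norm_num
  -- The largest margin allowed by `n a² ≤ 1`.
  refine le_trans ?_ (le_gameValue_linearClass he (a := 1 / Real.sqrt n) (by positivity) ha n [] 0
    0 (by simp) (by simp) (by simp) (by simp) (by simp) (by simp))
  rw [EReal.coe_le_coe_iff]
  have hlog : 1 / 2 ≤ Real.log n := by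
    have := Real.log_le_log two_pos hn'
    linarith [Real.log_two_gt_d9]
  -- The argument gives `√n / 2` without a logarithm; `log n ≥ 1/2` only serves to fit the stated
  -- form.
  have h1 : 1 / 4 * Real.sqrt n / Real.log n ≤ Real.sqrt n / 2 := by
    rw [div_le_iff₀ (by linarith)]
    nlinarith
  have hpos : 0 < 1 + 1 / Real.sqrt n := by positivity
  have h2 := Real.one_sub_inv_le_log_of_pos hpos
  have h3 : Real.sqrt n / 2 ≤ n * (1 - (1 + 1 / Real.sqrt n)⁻¹) := by
    have e : 1 - (1 + 1 / Real.sqrt n)⁻¹ = 1 / (Real.sqrt n + 1) := by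
      field_simp
      ring
    rw [e, mul_one_div, le_div_iff₀ (by linarith)]
    nlinarith
  have h4 := mul_le_mul_of_nonneg_left h2 hn0.le
  linarith

end Lower

theorem mainTheorem5 :
    ∃ (c C : ℝ) (k : ℕ), 0 < c ∧ 0 < C ∧
      ∀ (E : Type*) [NormedAddCommGroup E] [InnerProductSpace ℝ E] [CompleteSpace E] (n : ℕ),
        2 ≤ n →
          linearMinimaxRegret E n ≤ ((C * Real.sqrt n * Real.log n ^ k : ℝ) : EReal) ∧
          ((n : Cardinal) ≤ Module.rank ℝ E →
            ((c * Real.sqrt n / Real.log n ^ k : ℝ) : EReal) ≤ linearMinimaxRegret E n) := by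
  refine ⟨1 / 4, 8, 1, by norm_num, by norm_num, fun E _ _ _ n hn => ⟨?_, fun h => ?_⟩⟩
  · rw [pow_one]
    exact linearMinimaxRegret_le hn
  · rw [pow_one]
    exact le_linearMinimaxRegret hn h
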